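/- All graphs are finite and simple. The chromatic polynomial $P(G,t)$ is the polynomial whose value at each non-negative integer $t$ is the number of proper $t$-colourings of $G$. A double subdivision of an edge $uv$ of a graph $G$ deletes $uv$, adds two new vertices and joins both of them to $u$ and $v$. A generalised triangle is $K_3$ or any graph obtained from $K_3$ by a sequence of double subdivisions. A 2-cut of $G$ is a set $\{x,y\}$ of two distinct vertices whose removal increases the number of components of $G$; the $\{x,y\}$-bridges of $G$ are the induced subgraphs $G[V(C)\cup\{x,y\}]$, where $C$ ranges over the components of $G-\{x,y\}$. The 2-cut $\{x,y\}$ has property $P_1$ if in every $\{x,y\}$-bridge $B$ at least one of $x$ and $y$ has degree $1$ in $B$. Let $\mathcal{K}_1$ be the class of generalised triangles in which every 2-cut has property $P_1$. Lemma. If $G\in\mathcal{K}_1$, then $(-1)^{|V(G)|}P(G,t)>0$ for all $t\in(1,5/4]$. -/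

import Mathlib

open scoped Polynomial

universe u

namespace SimpleGraph

/-! ### The chromatic polynomial -/

/-- A function on the vertices is constant along the edges in `F` exactly if it factors through the
components of the graph with edge set `F`; so there are `n ^ c(F)` such functions to `Fin n`. -/
theorem card_constant_on_edges {V : Type u} [Finite V] (F : Set (Sym2 V)) (n : ℕ) :
    Nat.card {f : V → Fin n // ∀ a b, s(a, b) ∈ F → f a = f b} =
      n ^ Nat.card (fromEdgeSet F).ConnectedComponent := by
  have e : {f : V → Fin n // ∀ a b, s(a, b) ∈ F → f a = f b} ≃
      ((fromEdgeSet F).ConnectedComponent → Fin n) :=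
    { toFun := fun f => fun c => c.lift f.1 (by
        intro v w p _
        induction p with
        | nil => rfl
        | cons h _ ih =>
          rename_i hp
          rw [fromEdgeSet_adj] at h
          exact (f.2 _ _ h.1).trans (ih hp.of_cons))
      invFun := fun g => ⟨fun v => g ((fromEdgeSet F).connectedComponentMk v), by
        intro a b hab
        by_cases h : a = b
        · rw [h]
        · exact congrArg g <| ConnectedComponent.sound (Adj.reachable ((fromEdgeSet_adj F).2 ⟨hab, h⟩))⟩
      left_inv := fun f => rfl
      right_inv := fun g => by
        funext c
        induction c using ConnectedComponent.ind with
        | h v => rfl }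
  rw [Nat.card_congr e, Nat.card_fun, Nat.card_fin]

open Classical in
/-- There is exactly one polynomial whose value at every natural number `n` is the number of proper
`n`-colourings of the finite graph `G`. -/
theorem existsUnique_chromaticPolynomial {V : Type u} [Finite V] (G : SimpleGraph V) :
    ∃! p : ℤ[X], ∀ n : ℕ, p.eval (n : ℤ) = (Nat.card (G.Coloring (Fin n)) : ℤ) := by
  have := Fintype.ofFinite V
  refine existsUnique_of_exists_of_unique
    ⟨∑ F ∈ G.edgeFinset.powerset, (-1) ^ F.card *
      Polynomial.X ^ Nat.card (fromEdgeSet (F : Set (Sym2 V))).ConnectedComponent, ?_⟩ ?_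
  · intro n
    have hcol : (Nat.card (G.Coloring (Fin n)) : ℤ) =
        ∑ f : V → Fin n, ∏ e ∈ G.edgeFinset, (1 + -(if (e.map f).IsDiag then 1 else 0)) := by
      have e : G.Coloring (Fin n) ≃ {f : V → Fin n // ∀ a b, G.Adj a b → f a ≠ f b} :=
        { toFun := fun c => ⟨c, fun a b h => c.valid h⟩
          invFun := fun f => Coloring.mk f.1 (fun {a b} h => f.2 a b h)
          left_inv := fun c => rfl
          right_inv := fun f => rfl }
      rw [Nat.card_congr e, Nat.card_eq_fintype_card, Fintype.card_subtype,
        Finset.card_filter, Nat.cast_sum]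
      refine Finset.sum_congr rfl fun f _ => ?_
      split_ifs with h
      · rw [Finset.prod_eq_one]
        · rfl
        · intro e he
          induction e using Sym2.ind with
          | h a b =>
            rw [mem_edgeFinset, mem_edgeSet] at he
            simp [h a b he]
      · push Not at h
        obtain ⟨a, b, hab, hf⟩ := h
        rw [Finset.prod_eq_zero (i := s(a, b)) (by simpa using hab) (by simp [hf])]
        rfl
    rw [hcol, Polynomial.eval_finsetSum]
    simp_rw [Finset.prod_one_add]
    rw [Finset.sum_comm]
    refine Finset.sum_congr rfl fun F _ => ?_
    have hF : (Nat.card {f : V → Fin n // ∀ a b, s(a, b) ∈ (F : Set (Sym2 V)) → f a = f b} : ℤ) =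
        ∑ f : V → Fin n, ∏ e ∈ F, (if (e.map f).IsDiag then (1 : ℤ) else 0) := by
      rw [Nat.card_eq_fintype_card, Fintype.card_subtype, Finset.card_filter, Nat.cast_sum]
      refine Finset.sum_congr rfl fun f _ => ?_
      split_ifs with h
      · rw [Finset.prod_eq_one]
        · rfl
        · intro e he
          induction e using Sym2.ind with
          | h a b => simp [h a b he]
      · push Not at h
        obtain ⟨a, b, hab, hf⟩ := h
        rw [Finset.prod_eq_zero (i := s(a, b)) hab (by simp [hf])]
        rfl
    rw [card_constant_on_edges] at hF
    simp only [Finset.prod_neg, ← Finset.mul_sum, ← hF]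
    simp
  · intro p q hp hq
    refine Polynomial.eq_of_infinite_eval_eq p q
      ((Set.infinite_range_of_injective (Nat.cast_injective (R := ℤ))).mono ?_)
    rintro _ ⟨n, rfl⟩
    exact (hp n).trans (hq n).symm

/-- The chromatic polynomial of a finite graph: the polynomial that counts, for each natural number
`n`, the proper `n`-colourings. -/
noncomputable def chromaticPolynomial {V : Type u} [Finite V] (G : SimpleGraph V) : ℤ[X] :=
  (existsUnique_chromaticPolynomial G).choose

theorem chromaticPolynomial_eval {V : Type u} [Finite V] (G : SimpleGraph V) (n : ℕ) :
    G.chromaticPolynomial.eval (n : ℤ) = (Nat.card (G.Coloring (Fin n)) : ℤ) :=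
  (existsUnique_chromaticPolynomial G).choose_spec.1 n

/-! ### Generalised triangles -/

/-- Double subdivision of the edge `uv`: delete `uv`, add two new vertices (`Sum.inr 0` and
`Sum.inr 1`) and join both of them to `u` and to `v`, and to nothing else. -/
def doubleSubdivision {V : Type u} (G : SimpleGraph V) (u v : V) : SimpleGraph (V ⊕ Fin 2) where
  Adj
    | .inl a, .inl b => G.Adj a b ∧ s(a, b) ≠ s(u, v)
    | .inl a, .inr _ => a = u ∨ a = v
    | .inr _, .inl b => b = u ∨ b = v
    | .inr _, .inr _ => False
  symm := ⟨by
    rintro (a | i) (b | j) h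
    · exact ⟨h.1.symm, by rw [Sym2.eq_swap]; exact h.2⟩
    · exact h
    · exact h
    · exact h⟩
  loopless := ⟨by
    rintro (a | i) h
    · exact G.loopless.irrefl a h.1
    · exact h⟩

/-- A generalised triangle is (up to isomorphism) `K₃` or a graph that arises from `K₃` by a
sequence of double subdivisions of edges. -/
inductive IsGeneralisedTriangle : ∀ {V : Type u}, SimpleGraph V → Prop
  | triangle {V : Type u} (G : SimpleGraph V)
      (e : G ≃g (⊤ : SimpleGraph (Fin 3))) : IsGeneralisedTriangle G
  | doubleSubdivision {V W : Type u} (G : SimpleGraph V) (G' : SimpleGraph W) (u v : V)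
      (hG : IsGeneralisedTriangle G) (huv : G.Adj u v)
      (e : G' ≃g G.doubleSubdivision u v) : IsGeneralisedTriangle G'

/-! ### 2-cuts, bridges and the class `K₁` -/

/-- A set `S` of vertices of a finite graph is a cut-set if its removal increases the number of
components. -/
def IsCutSet {V : Type u} (G : SimpleGraph V) (S : Set V) : Prop :=
  Nat.card G.ConnectedComponent < Nat.card (G.ComponentCompl S)

/-- `{x, y}` is a 2-cut of `G`: a cut-set with exactly two elements. -/
def IsTwoCut {V : Type u} (G : SimpleGraph V) (x y : V) : Prop :=
  x ≠ y ∧ G.IsCutSet {x, y}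

/-- The `{x, y}`-bridge of `G` that belongs to the component `C` of `G - {x, y}`: the subgraph of
`G` induced by `V(C) ∪ {x, y}`. -/
def bridge {V : Type u} (G : SimpleGraph V) (x y : V) (C : G.ComponentCompl {x, y}) : G.Subgraph :=
  (⊤ : G.Subgraph).induce (C.supp ∪ {x, y})

/-- Property `P₁` of the pair `{x, y}`: in every `{x, y}`-bridge at least one of `x`, `y` has
degree 1. -/
def HasPropertyP1 {V : Type u} (G : SimpleGraph V) (x y : V) : Prop :=
  ∀ C : G.ComponentCompl {x, y},
    ((G.bridge x y C).neighborSet x).ncard = 1 ∨ ((G.bridge x y C).neighborSet y).ncard = 1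

/-- The class `K₁`: generalised triangles all of whose 2-cuts have property `P₁`. -/
def IsInK1 {V : Type u} (G : SimpleGraph V) : Prop :=
  G.IsGeneralisedTriangle ∧ ∀ x y : V, G.IsTwoCut x y → G.HasPropertyP1 x y

end SimpleGraph

/-!
Give each edge a weight `(a, b)`: in a colouring it contributes `a` if its ends differ in colour and
`b` if they agree, so that all weights `(1, 0)` give the chromatic polynomial. The four edges at the
new vertices of a double subdivision are two parallel pairs of edges in series, and therefore act as
one edge between the old vertices. Let `1 < t ≤ 5 / 4`. If two edges in series have `a > 0` and
`b / a ≤ 1 / 4`, and one of them has `b = 0`, then the edge that replaces them has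
`-1 / 2 ≤ b / a < 0`; two such edges in parallel give `a > 0` and `0 < b / a ≤ 1 / 4` again.
Property `P₁` ensures that every series pair met when the double subdivisions are undone contains an
edge that has not replaced anything, so still has `b = 0`. This leaves a triangle, whose weighted
sum is negative, and the number of vertices of a generalised triangle is odd.
-/

namespace GeneralisedTriangle

open SimpleGraph

section Separation

variable {V W : Type*} {G : SimpleGraph V} {H : SimpleGraph W} {S C : Set V}

/-- `C` is a union of components of `G - S`. -/
def IsClosedOff (G : SimpleGraph V) (S C : Set V) : Prop :=
  ∀ c ∈ C, c ∉ S ∧ ∀ d, G.Adj c d → d ∈ C ∨ d ∈ S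

/-- `C` is the vertex set of a component of `G - S`, encoded without walks as a minimal nonempty
union of components. -/
def IsPiece (G : SimpleGraph V) (S C : Set V) : Prop :=
  Minimal (fun D => IsClosedOff G S D ∧ D.Nonempty) C

/-- `G - S` has at most one component. -/
def IsNonseparating (G : SimpleGraph V) (S : Set V) : Prop :=
  ∀ C, IsClosedOff G S C → C.Nonempty → C = Sᶜ

theorem IsNonseparating.isPiece_compl (h : IsNonseparating G S) (hne : Sᶜ.Nonempty) :
    IsPiece G S Sᶜ :=
  ⟨⟨fun _ hc => ⟨hc, fun d _ => (em (d ∈ S)).symm⟩, hne⟩, fun D hD _ => (h D hD.1 hD.2).ge⟩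

theorem isNonseparating_top (S : Set V) : IsNonseparating (⊤ : SimpleGraph V) S := by
  rintro C hC ⟨c, hc⟩
  refine Set.Subset.antisymm (fun d hd => (hC d hd).1) fun d hd => ?_
  obtain rfl | hcd := eq_or_ne c d
  · exact hc
  · exact ((hC c hc).2 d hcd).resolve_right hd

theorem IsNonseparating.of_insert {y z : V} (h : IsNonseparating G (insert y S)) (hy : y ∉ S)
    (hz : z ∉ S) (hyz : G.Adj y z) : IsNonseparating G S := by
  intro C hC hne
  have hcl : IsClosedOff G (insert y S) (C \ {y}) := by grind [IsClosedOff]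
  have hyC : y ∈ C := by
    by_contra hyC
    rw [Set.sdiff_singleton_eq_self hyC] at hcl
    have hzC : z ∈ C := (h C hcl hne).ge (by grind [hyz.ne'])
    exact hyC (((hC z hzC).2 y hyz.symm).resolve_right hy)
  have hzC : z ∈ C := ((hC y hyC).2 z hyz).resolve_right hz
  have heq : C \ {y} = (insert y S)ᶜ := h _ hcl ⟨z, hzC, hyz.ne'⟩
  ext x
  have hx := Set.ext_iff.1 heq x
  grind

theorem IsNonseparating.connected [Nonempty V] (h : IsNonseparating G ∅) : G.Connected := by
  let x : V := Classical.arbitrary V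
  refine (connected_iff_exists_forall_reachable G).2 ⟨x, fun z => ?_⟩
  have hcl : IsClosedOff G ∅ {z | G.Reachable x z} :=
    fun c hc => ⟨id, fun d hcd => .inl (hc.trans hcd.reachable)⟩
  exact (h _ hcl ⟨x, .refl x⟩).ge (Set.notMem_empty z)

theorem IsPiece.exists_componentCompl_supp_eq (hC : IsPiece G S C) :
    ∃ K : G.ComponentCompl S, K.supp = C := by
  obtain ⟨⟨hcl, c, hc⟩, hmin⟩ := hC
  have hcS := (hcl c hc).1
  let K := G.componentComplMk hcS
  have hK : IsClosedOff G S K.supp := fun a ha =>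
    ⟨ComponentCompl.notMem_of_mem ha, fun d had =>
      (em (d ∈ S)).symm.imp_left fun hd => ComponentCompl.mem_of_adj a d ha hd had⟩
  have hKC : K.supp ⊆ C := by
    rintro d ⟨hd, hdK⟩
    obtain ⟨p⟩ := ConnectedComponent.exact hdK.symm
    suffices ∀ a b : (Sᶜ : Set V), (G.induce Sᶜ).Walk a b → a.1 ∈ C → b.1 ∈ C from this _ _ p hc
    intro a b p
    induction p with
    | nil => exact id
    | @cons a b _ hab _ ih => exact fun ha => ih (((hcl a ha).2 b hab).resolve_right b.2)
  exact ⟨K, hKC.antisymm (hmin ⟨hK, c, G.componentComplMk_mem hcS⟩ hKC)⟩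

theorem IsClosedOff.preimage_iso (φ : G ≃g H) {S C : Set W} (h : IsClosedOff H S C) :
    IsClosedOff G (φ ⁻¹' S) (φ ⁻¹' C) :=
  fun _ hc => ⟨(h _ hc).1, fun _ hd => (h _ hc).2 _ (φ.map_adj_iff.2 hd)⟩

theorem IsClosedOff.image_iso (φ : G ≃g H) (h : IsClosedOff G S C) :
    IsClosedOff H (φ '' S) (φ '' C) := by
  rintro _ ⟨c, hc, rfl⟩
  refine ⟨φ.injective.mem_set_image.not.2 (h c hc).1, fun d hcd => ?_⟩
  obtain ⟨d, rfl⟩ := φ.surjective d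
  simpa only [φ.injective.mem_set_image] using (h c hc).2 d (φ.map_adj_iff.1 hcd)

theorem IsPiece.image_iso (φ : G ≃g H) (h : IsPiece G S C) : IsPiece H (φ '' S) (φ '' C) := by
  refine ⟨⟨h.1.1.image_iso φ, h.1.2.image φ⟩, fun D ⟨hD, hne⟩ hDC => ?_⟩
  have hpre : IsClosedOff G S (φ ⁻¹' D) := by
    simpa only [Set.preimage_image_eq _ φ.injective] using hD.preimage_iso φ
  exact Set.image_subset_iff.2
    (h.2 ⟨hpre, hne.preimage φ.surjective⟩ ((Set.preimage_mono hDC).trans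
      (Set.preimage_image_eq _ φ.injective).le))

theorem IsNonseparating.preimage_iso (φ : G ≃g H) {S : Set W} (h : IsNonseparating H S) :
    IsNonseparating G (φ ⁻¹' S) := by
  intro C hC hne
  have hcl : IsClosedOff H S (φ '' C) := by
    simpa only [Set.image_preimage_eq _ φ.surjective] using hC.image_iso φ
  rw [← Set.preimage_compl, ← h _ hcl (hne.image φ), Set.preimage_image_eq _ φ.injective]

theorem nontrivial_neighborSet_of_iso (φ : G ≃g H) {x : V}
    (h : (H.neighborSet (φ x)).Nontrivial) : (G.neighborSet x).Nontrivial := by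
  obtain ⟨a, ha, b, hb, hab⟩ := h
  obtain ⟨a, rfl⟩ := φ.surjective a
  obtain ⟨b, rfl⟩ := φ.surjective b
  exact ⟨a, φ.map_adj_iff.1 ha, b, φ.map_adj_iff.1 hb, ne_of_apply_ne φ hab⟩

end Separation

section DoubleSubdivision

variable {V : Type*} {G : SimpleGraph V} {u v : V}

@[simp]
theorem doubleSubdivision_adj_inl_inl {x y : V} :
    (G.doubleSubdivision u v).Adj (.inl x) (.inl y) ↔ G.Adj x y ∧ s(x, y) ≠ s(u, v) :=
  Iff.rfl

@[simp]
theorem doubleSubdivision_adj_inl_inr {x : V} {i : Fin 2} :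
    (G.doubleSubdivision u v).Adj (.inl x) (.inr i) ↔ x = u ∨ x = v :=
  Iff.rfl

@[simp]
theorem doubleSubdivision_adj_inr_inl {x : V} {i : Fin 2} :
    (G.doubleSubdivision u v).Adj (.inr i) (.inl x) ↔ x = u ∨ x = v :=
  Iff.rfl

@[simp]
theorem not_doubleSubdivision_adj_inr_inr {i j : Fin 2} :
    ¬ (G.doubleSubdivision u v).Adj (.inr i) (.inr j) :=
  id

theorem IsClosedOff.preimage_inl {S C : Set (V ⊕ Fin 2)} {i : Fin 2} (hi : .inr i ∉ S)
    (hC : IsClosedOff (G.doubleSubdivision u v) S C) :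
    IsClosedOff G (Sum.inl ⁻¹' S) (Sum.inl ⁻¹' C) := by
  refine fun c hc => ⟨(hC _ hc).1, fun d hcd => ?_⟩
  by_cases he : s(c, d) = s(u, v)
  · have hiC : .inr i ∈ C := ((hC _ hc).2 (.inr i)
      (doubleSubdivision_adj_inl_inr.2 (by grind))).resolve_right hi
    exact (hC _ hiC).2 (.inl d) (doubleSubdivision_adj_inr_inl.2 (by grind))
  · exact (hC _ hc).2 (.inl d) ⟨hcd, he⟩

theorem IsClosedOff.inl_mem_of_inr_mem {S C : Set (V ⊕ Fin 2)} {i : Fin 2}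
    (hC : IsClosedOff (G.doubleSubdivision u v) S C) (hi : .inr i ∈ C) {x : V}
    (hx : x = u ∨ x = v) (hxS : .inl x ∉ S) : .inl x ∈ C :=
  ((hC _ hi).2 _ (doubleSubdivision_adj_inr_inl.2 hx)).resolve_right hxS

theorem IsClosedOff.inr_mem_of_inl_mem {S C : Set (V ⊕ Fin 2)} {i : Fin 2}
    (hC : IsClosedOff (G.doubleSubdivision u v) S C) {x : V} (hx : x = u ∨ x = v)
    (hxC : .inl x ∈ C) (hi : .inr i ∉ S) : .inr i ∈ C :=
  ((hC _ hxC).2 _ (doubleSubdivision_adj_inl_inr.2 hx)).resolve_right hi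

theorem IsNonseparating.doubleSubdivision {S : Set (V ⊕ Fin 2)} {i : Fin 2} {x : V}
    (h : IsNonseparating G (Sum.inl ⁻¹' S)) (hi : .inr i ∉ S) (hx : x = u ∨ x = v)
    (hxS : .inl x ∉ S) : IsNonseparating (G.doubleSubdivision u v) S := by
  rintro C hC ⟨w, hw⟩
  have hne : (Sum.inl ⁻¹' C : Set V).Nonempty := by
    rcases w with z | j
    · exact ⟨z, hw⟩
    · exact ⟨x, hC.inl_mem_of_inr_mem hw hx hxS⟩
  have hpre : ∀ z : V, .inl z ∈ C ↔ .inl z ∉ S := Set.ext_iff.1 (h _ (hC.preimage_inl hi) hne)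
  refine Set.Subset.antisymm (fun c hc => (hC c hc).1) ?_
  rintro (z | j) hz
  · exact (hpre z).2 hz
  · exact hC.inr_mem_of_inl_mem hx ((hpre x).2 hxS) hz

theorem nontrivial_neighborSet_doubleSubdivision (huv : G.Adj u v)
    (hG : ∀ x, (G.neighborSet x).Nontrivial) (a : V ⊕ Fin 2) :
    ((G.doubleSubdivision u v).neighborSet a).Nontrivial := by
  rcases a with x | i
  · by_cases hx : x = u ∨ x = v
    · exact ⟨.inr 0, hx, .inr 1, hx, by simp⟩
    · obtain ⟨y, hy, z, hz, hyz⟩ := hG x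
      refine ⟨.inl y, ⟨hy, ?_⟩, .inl z, ⟨hz, ?_⟩, Sum.inl_injective.ne hyz⟩ <;> grind
  · exact ⟨.inl u, .inl rfl, .inl v, .inr rfl, Sum.inl_injective.ne huv.ne⟩

theorem IsNonseparating.singleton_of_pair {x y : V} (h : IsNonseparating G {x, y})
    (hxy : G.Adj x y) (hy : (G.neighborSet y).Nontrivial) : IsNonseparating G {x} := by
  obtain ⟨z, hyz, hzx⟩ := hy.exists_ne x
  rw [Set.pair_comm] at h
  exact h.of_insert hxy.ne' hzx hyz

theorem isNonseparating_pair_doubleSubdivision (huv : G.Adj u v)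
    (hdeg : ∀ x, (G.neighborSet x).Nontrivial)
    (hG : ∀ x y, G.Adj x y → IsNonseparating G {x, y}) {a b : V ⊕ Fin 2}
    (hab : (G.doubleSubdivision u v).Adj a b) :
    IsNonseparating (G.doubleSubdivision u v) {a, b} := by
  have hnew : ∀ {x : V}, x = u ∨ x = v → ∀ i : Fin 2,
      IsNonseparating (G.doubleSubdivision u v) {.inl x, .inr i} := by
    intro x hx i
    obtain ⟨y, hxy, hy⟩ : ∃ y, G.Adj x y ∧ (y = u ∨ y = v) := by grind [huv.symm]
    obtain ⟨j, hj⟩ := exists_ne i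
    have hpre : Sum.inl ⁻¹' ({.inl x, .inr i} : Set (V ⊕ Fin 2)) = {x} := by ext; simp
    refine .doubleSubdivision (i := j) ?_ (by simp [hj]) hy (by simp [hxy.ne'])
    exact hpre ▸ (hG x y hxy).singleton_of_pair hxy (hdeg y)
  match a, b with
  | .inl x, .inl y =>
    obtain ⟨w, hw, hwx, hwy⟩ : ∃ w, (w = u ∨ w = v) ∧ w ≠ x ∧ w ≠ y := by
      have huv' := huv.ne
      by_contra! hcon
      have hu := hcon u (.inl rfl)
      have hv := hcon v (.inr rfl)
      exact hab.2 (Sym2.eq_iff.2 (by grind))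
    have hpre : Sum.inl ⁻¹' ({.inl x, .inl y} : Set (V ⊕ Fin 2)) = {x, y} := by ext; simp
    exact .doubleSubdivision (i := 0) (hpre ▸ hG x y hab.1) (by simp) hw (by simp [hwx, hwy])
  | .inl x, .inr i => exact hnew hab i
  | .inr i, .inl x => exact Set.pair_comm _ _ ▸ hnew hab i
  | .inr i, .inr j => exact hab.elim

end DoubleSubdivision

section IsGeneralisedTriangle

variable {V : Type u} {G : SimpleGraph V}

theorem finite_and_odd_card (hG : G.IsGeneralisedTriangle) : Finite V ∧ Odd (Nat.card V) := by
  induction hG with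
  | triangle G φ =>
    exact ⟨.of_equiv _ φ.toEquiv.symm, by rw [Nat.card_congr φ.toEquiv, Nat.card_fin]; decide⟩
  | doubleSubdivision G G' u v _ _ φ ih =>
    obtain ⟨_, hodd⟩ := ih
    refine ⟨.of_equiv _ φ.toEquiv.symm, ?_⟩
    rw [Nat.card_congr φ.toEquiv, Nat.card_sum, Nat.card_fin]
    exact hodd.add_even even_two

theorem nontrivial_neighborSet (hG : G.IsGeneralisedTriangle) (x : V) :
    (G.neighborSet x).Nontrivial := by
  induction hG with
  | triangle G φ =>
    refine nontrivial_neighborSet_of_iso φ ?_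
    generalize φ x = i
    exact ⟨i + 1, by revert i; decide, i + 2, by revert i; decide, by revert i; decide⟩
  | doubleSubdivision G G' u v _ huv φ ih =>
    exact nontrivial_neighborSet_of_iso φ (nontrivial_neighborSet_doubleSubdivision huv ih (φ x))

theorem isNonseparating_pair (hG : G.IsGeneralisedTriangle) {x y : V} (hxy : G.Adj x y) :
    IsNonseparating G {x, y} := by
  induction hG with
  | triangle G φ =>
    simpa [Set.preimage_image_eq _ φ.injective] using
      (isNonseparating_top (φ '' {x, y})).preimage_iso φ
  | doubleSubdivision G G' u v hG huv φ ih =>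
    have h := isNonseparating_pair_doubleSubdivision huv (nontrivial_neighborSet hG)
      (fun _ _ => ih) (φ.map_adj_iff.2 hxy)
    rw [← Set.image_pair] at h
    simpa only [Set.preimage_image_eq _ φ.injective] using h.preimage_iso φ

end IsGeneralisedTriangle

section RelativeP1

variable {V W : Type*} {G : SimpleGraph V} {H : SimpleGraph W} {R : Set (Sym2 V)} {S C : Set V}
  {x y u v : V}

/-- `x` has at most one edge to `C`, and this edge is real, that is, it belongs to `R`. In the
bridge of a 2-cut `{x, y}` with interior `C` this says that `x` has degree at most 1 (apart from the
edge `xy`) also after the virtual edges, those outside `R`, are expanded. -/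
def IsLeafOn (G : SimpleGraph V) (R : Set (Sym2 V)) (x : V) (C : Set V) : Prop :=
  (G.neighborSet x ∩ C).Subsingleton ∧ ∀ z ∈ C, G.Adj x z → s(x, z) ∈ R

/-- Property `P₁` of all the 2-cuts `{x, y}` that consist of vertices of `G` in the larger graph in
which each virtual edge of `G`, that is, each edge outside `R`, is expanded to a subgraph with more
than two vertices. If `G - {x, y}` is connected, then `{x, y}` is such a 2-cut only if `xy` is a
virtual edge. -/
def HasRelativeP1 (G : SimpleGraph V) (R : Set (Sym2 V)) : Prop :=
  ∀ x y C, x ≠ y → IsPiece G {x, y} C → (C = {x, y}ᶜ → G.Adj x y ∧ s(x, y) ∉ R) →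
    IsLeafOn G R x C ∨ IsLeafOn G R y C

theorem HasRelativeP1.isLeafOn_of_notMem (h : HasRelativeP1 G R)
    (hxy : IsNonseparating G {x, y}) (hne : ({x, y}ᶜ : Set V).Nonempty) (hadj : G.Adj x y)
    (hR : s(x, y) ∉ R) : IsLeafOn G R x {x, y}ᶜ ∨ IsLeafOn G R y {x, y}ᶜ :=
  h x y _ hadj.ne (hxy.isPiece_compl hne) fun _ => ⟨hadj, hR⟩

theorem IsLeafOn.of_image_iso (φ : G ≃g H) {R : Set (Sym2 W)}
    (h : IsLeafOn H R (φ x) (φ '' C)) : IsLeafOn G (Sym2.map φ ⁻¹' R) x C :=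
  ⟨fun _ hz _ hz' => φ.injective (h.1 ⟨φ.map_adj_iff.2 hz.1, _, hz.2, rfl⟩
    ⟨φ.map_adj_iff.2 hz'.1, _, hz'.2, rfl⟩),
    fun z hz hxz => h.2 (φ z) ⟨z, hz, rfl⟩ (φ.map_adj_iff.2 hxz)⟩

theorem HasRelativeP1.comap_iso (φ : G ≃g H) {R : Set (Sym2 W)} (h : HasRelativeP1 H R) :
    HasRelativeP1 G (Sym2.map φ ⁻¹' R) := by
  intro x y C hxy hC hvirtual
  have hpair : φ '' {x, y} = {φ x, φ y} := Set.image_pair φ x y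
  refine (h (φ x) (φ y) (φ '' C) (φ.injective.ne hxy) (hpair ▸ hC.image_iso φ) fun hcompl => ?_).imp
    (·.of_image_iso φ) (·.of_image_iso φ)
  rw [← hpair, ← Set.image_compl_eq φ.bijective] at hcompl
  obtain ⟨hadj, hR⟩ := hvirtual (φ.injective.image_injective hcompl)
  exact ⟨φ.map_adj_iff.2 hadj, hR⟩

/-- The vertex set in the double subdivision of the edge `uv` that corresponds to a union `C` of
components of the graph with `uv` unsubdivided: the new vertices belong to it if `u` or `v` does. -/
def expand (u v : V) (C : Set V) : Set (V ⊕ Fin 2) :=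
  {a | a.elim (· ∈ C) fun _ => u ∈ C ∨ v ∈ C}

@[simp]
theorem inl_mem_expand : .inl x ∈ expand u v C ↔ x ∈ C :=
  Iff.rfl

@[simp]
theorem inr_mem_expand {i : Fin 2} : .inr i ∈ expand u v C ↔ u ∈ C ∨ v ∈ C :=
  Iff.rfl

theorem IsClosedOff.expand (hC : IsClosedOff G S C) (huv : G.Adj u v) :
    IsClosedOff (G.doubleSubdivision u v) (Sum.inl '' S) (expand u v C) := by
  rintro (c | i) hc
  · refine ⟨by simpa using (hC c hc).1, ?_⟩
    rintro (d | j) hcd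
    · simpa using (hC c hc).2 d hcd.1
    · rcases hcd with rfl | rfl
      · exact .inl (.inl hc)
      · exact .inl (.inr hc)
  · refine ⟨by simp, ?_⟩
    rintro (d | j) hid
    · have hu := fun hu => (hC u hu).2 v huv
      have hv := fun hv => (hC v hv).2 u huv.symm
      simp only [inr_mem_expand, doubleSubdivision_adj_inr_inl] at hc hid
      simp only [inl_mem_expand, Sum.inl_injective.mem_set_image]
      grind
    · exact hid.elim

theorem IsPiece.expand (hC : IsPiece G S C) (huv : G.Adj u v) :
    IsPiece (G.doubleSubdivision u v) (Sum.inl '' S) (expand u v C) := by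
  obtain ⟨⟨hcl, c, hc⟩, hmin⟩ := hC
  refine ⟨⟨hcl.expand huv, .inl c, hc⟩, fun D ⟨hD, w, hw⟩ hDC => ?_⟩
  have hsub : Sum.inl ⁻¹' D ⊆ C := fun z hz => hDC hz
  have hpre : IsClosedOff G S (Sum.inl ⁻¹' D) := by
    simpa only [Set.preimage_image_eq _ Sum.inl_injective] using
      hD.preimage_inl (i := 0) (by simp)
  have hne : (Sum.inl ⁻¹' D).Nonempty := by
    rcases w with z | i
    · exact ⟨z, hw⟩
    · obtain ⟨x, hx, hxC⟩ : ∃ x, (x = u ∨ x = v) ∧ x ∈ C := by simpa using hDC hw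
      exact ⟨x, hD.inl_mem_of_inr_mem hw hx (by simpa using (hcl x hxC).1)⟩
  have hCD : C ⊆ Sum.inl ⁻¹' D := hmin ⟨hpre, hne⟩ hsub
  rintro (z | i) hz
  · exact hCD hz
  · rcases hz with hu | hv
    · exact hD.inr_mem_of_inl_mem (.inl rfl) (hCD hu) (by simp)
    · exact hD.inr_mem_of_inl_mem (.inr rfl) (hCD hv) (by simp)

theorem IsLeafOn.of_expand {R' : Set (Sym2 (V ⊕ Fin 2))}
    (h : IsLeafOn (G.doubleSubdivision u v) R' (.inl x) (expand u v C))
    (hR : ∀ e, e ≠ s(u, v) → e.map Sum.inl ∈ R' → e ∈ R) : IsLeafOn G R x C := by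
  have hne : ∀ z ∈ C, s(x, z) ≠ s(u, v) := by
    intro z hz he
    have hx : x = u ∨ x = v := by grind
    have hi : ∀ i : Fin 2, .inr i ∈ (G.doubleSubdivision u v).neighborSet (.inl x) ∩ expand u v C :=
      fun i => ⟨hx, by simp only [inr_mem_expand]; grind⟩
    simpa using h.1 (hi 0) (hi 1)
  have hadj : ∀ z ∈ C, G.Adj x z → (G.doubleSubdivision u v).Adj (.inl x) (.inl z) :=
    fun z hz hxz => ⟨hxz, hne z hz⟩
  exact ⟨fun z hz z' hz' => Sum.inl_injective
      (h.1 ⟨hadj z hz.2 hz.1, hz.2⟩ ⟨hadj z' hz'.2 hz'.1, hz'.2⟩),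
    fun z hz hxz => hR _ (hne z hz) (h.2 (.inl z) hz (hadj z hz hxz))⟩

theorem HasRelativeP1.of_doubleSubdivision {R' : Set (Sym2 (V ⊕ Fin 2))}
    (h : HasRelativeP1 (G.doubleSubdivision u v) R') (huv : G.Adj u v)
    (hR : ∀ e, e ≠ s(u, v) → e.map Sum.inl ∈ R' → e ∈ R) : HasRelativeP1 G R := by
  intro x y C hxy hC hvirtual
  have hpair : Sum.inl '' {x, y} = ({.inl x, .inl y} : Set (V ⊕ Fin 2)) := Set.image_pair ..
  refine (h (.inl x) (.inl y) (expand u v C) (Sum.inl_injective.ne hxy)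
    (hpair ▸ hC.expand huv) fun hcompl => ?_).imp (·.of_expand hR) (·.of_expand hR)
  have hmem := Set.ext_iff.1 hcompl
  obtain ⟨hadj, hxyR⟩ := hvirtual (by ext z; simpa using hmem (.inl z))
  have hne : s(x, y) ≠ s(u, v) := by
    intro he
    have huvC : u ∈ C ∨ v ∈ C := by simpa using hmem (.inr 0)
    have hdisj := fun z hz => (hC.1.1 z hz).1
    simp only [Set.mem_insert_iff, Set.mem_singleton_iff] at hdisj
    grind
  exact ⟨⟨hadj, hne⟩, fun hR' => hxyR (hR _ hne hR')⟩

end RelativeP1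

section PropertyP1

variable {V : Type u} {G : SimpleGraph V}

theorem HasRelativeP1.mem_of_triangle {R : Set (Sym2 V)} (h : HasRelativeP1 G R)
    (hG : G.IsGeneralisedTriangle) {x y z : V} (hxy : G.Adj x y) (hyz : G.Adj y z)
    (hxz : G.Adj x z) : s(x, y) ∈ R ∨ s(y, z) ∈ R ∨ s(x, z) ∈ R := by
  by_contra! hR
  have hz : z ∈ ({x, y}ᶜ : Set V) := by simp [hxz.ne', hyz.ne']
  rcases h.isLeafOn_of_notMem (isNonseparating_pair hG hxy) ⟨z, hz⟩ hxy hR.1 with hx | hy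
  · exact hR.2.2 (hx.2 z hz hxz)
  · exact hR.2.1 (hy.2 z hz hyz)

theorem HasRelativeP1.inl_inr_mem {u v : V} {R : Set (Sym2 (V ⊕ Fin 2))}
    (h : HasRelativeP1 (G.doubleSubdivision u v) R) (hG : G.IsGeneralisedTriangle)
    (huv : G.Adj u v) (i : Fin 2) : s(.inl u, .inr i) ∈ R ∨ s(.inl v, .inr i) ∈ R := by
  by_contra! hR
  have hui : (G.doubleSubdivision u v).Adj (.inl u) (.inr i) := .inl rfl
  have hnonsep := isNonseparating_pair_doubleSubdivision huv (nontrivial_neighborSet hG)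
    (fun _ _ => isNonseparating_pair hG) hui
  have hv : .inl v ∈ ({.inl u, .inr i}ᶜ : Set (V ⊕ Fin 2)) := by simp [huv.ne']
  rcases h.isLeafOn_of_notMem hnonsep ⟨_, hv⟩ hui hR.1 with hu | hi
  · obtain ⟨j, hj⟩ := exists_ne i
    obtain ⟨z, huz, hzv⟩ := (nontrivial_neighborSet hG u).exists_ne v
    have hadj : (G.doubleSubdivision u v).Adj (.inl u) (.inl z) := ⟨huz, by grind⟩
    have hadj' : (G.doubleSubdivision u v).Adj (.inl u) (.inr j) := .inl rfl
    have hz : .inl z ∈ ({.inl u, .inr i}ᶜ : Set (V ⊕ Fin 2)) := by simp [huz.ne']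
    have hj : .inr j ∈ ({.inl u, .inr i}ᶜ : Set (V ⊕ Fin 2)) := by simp [hj]
    simpa using hu.1 ⟨hadj, hz⟩ ⟨hadj', hj⟩
  · have hiv : (G.doubleSubdivision u v).Adj (.inr i) (.inl v) := .inr rfl
    exact hR.2 (Sym2.eq_swap ▸ hi.2 (.inl v) hv hiv)

theorem connected (hG : G.IsGeneralisedTriangle) [Nonempty V] :
    G.Connected := by
  obtain ⟨y, hxy⟩ := (nontrivial_neighborSet hG (Classical.arbitrary V)).nonempty
  have hx := (isNonseparating_pair hG hxy).singleton_of_pair hxy (nontrivial_neighborSet hG y)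
  rw [← insert_empty_eq] at hx
  exact (hx.of_insert (Set.notMem_empty _) (Set.notMem_empty _) hxy).connected

theorem IsPiece.isTwoCut {x y : V} {C : Set V} (hC : IsPiece G {x, y} C)
    (hG : G.IsGeneralisedTriangle) (hxy : x ≠ y) (hne : C ≠ {x, y}ᶜ) : G.IsTwoCut x y := by
  obtain ⟨K, rfl⟩ := hC.exists_componentCompl_supp_eq
  obtain ⟨z, hz, hzK⟩ : ∃ z ∉ ({x, y} : Set V), z ∉ K.supp := by
    by_contra! hcon
    exact hne (Set.Subset.antisymm (fun z hz => ComponentCompl.notMem_of_mem hz) hcon)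
  have hKz : K ≠ G.componentComplMk hz := by
    rintro rfl
    exact hzK (G.componentComplMk_mem hz)
  have : Nonempty V := ⟨x⟩
  have : Finite V := (finite_and_odd_card hG).1
  have : Finite (G.ComponentCompl {x, y}) := Quot.finite _
  have : Nontrivial (G.ComponentCompl {x, y}) := ⟨_, _, hKz⟩
  have := (connected hG).preconnected.subsingleton_connectedComponent
  exact ⟨hxy, (Finite.card_le_one_iff_subsingleton.2 this).trans_lt Finite.one_lt_card⟩

theorem isLeafOn_univ_of_ncard_bridge {x y w : V} {K : G.ComponentCompl {x, y}}
    (hw : w ∈ ({x, y} : Set V)) (hcard : ((G.bridge x y K).neighborSet w).ncard = 1) :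
    IsLeafOn G Set.univ w K.supp := by
  obtain ⟨a, ha⟩ := Set.ncard_eq_one.1 hcard
  have hsub : G.neighborSet w ∩ K.supp ⊆ (G.bridge x y K).neighborSet w :=
    fun z hz => ⟨.inr hw, .inl hz.2, hz.1⟩
  exact ⟨(ha ▸ Set.subsingleton_singleton).anti hsub, fun _ _ _ => trivial⟩

theorem hasRelativeP1_univ (hG : G.IsInK1) : HasRelativeP1 G Set.univ := by
  intro x y C hxy hC hvirtual
  have hcut := hC.isTwoCut hG.1 hxy fun hcompl => (hvirtual hcompl).2 trivial
  obtain ⟨K, rfl⟩ := hC.exists_componentCompl_supp_eq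
  exact (hG.2 x y hcut K).imp (isLeafOn_univ_of_ncard_bridge (by simp))
    (isLeafOn_univ_of_ncard_bridge (by simp))

end PropertyP1

section Weights

variable {R S α : Type*} [DecidableEq α]

/-- The contribution to a colouring of an edge whose ends have the colours `d`: an edge weight
`p = (a, b)` contributes `a` if the ends differ in colour and `b` if they agree. Parallel edges
combine to the edge whose weight is the product in `R × R`. -/
def edgeFactor (p : R × R) (d : Sym2 α) : R :=
  if d.IsDiag then p.2 else p.1

theorem edgeFactor_mk (p : R × R) (i j : α) :
    edgeFactor p s(i, j) = if i = j then p.2 else p.1 := by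
  simp [edgeFactor]

theorem edgeFactor_mul [Mul R] (p p' : R × R) (d : Sym2 α) :
    edgeFactor (p * p') d = edgeFactor p d * edgeFactor p' d := by
  unfold edgeFactor
  split_ifs <;> rfl

variable [CommRing R] [CommRing S]

/-- The weight, with `q` colours, of the edge that can replace two edges in series of weights `p`
and `p'`. -/
def series (q : R) (p p' : R × R) : R × R :=
  ((q - 2) * p.1 * p'.1 + p.1 * p'.2 + p.2 * p'.1, p.2 * p'.2 + (q - 1) * p.1 * p'.1)

theorem map_series (φ : R →+* S) (q : R) (p p' : R × R) :
    φ.prodMap φ (series q p p') = series (φ q) (φ.prodMap φ p) (φ.prodMap φ p') := by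
  simp [series, map_ofNat]

theorem sum_edgeFactor (n : ℕ) (p : R × R) (i : Fin n) :
    ∑ c, edgeFactor p s(i, c) = p.2 + (n - 1) * p.1 := by
  have hsplit : ∀ c, edgeFactor p s(i, c) = p.1 + if i = c then p.2 - p.1 else 0 := by
    intro c
    rw [edgeFactor_mk]
    split_ifs <;> ring
  simp only [hsplit, Finset.sum_add_distrib, Finset.sum_ite_eq, Finset.mem_univ, if_true,
    Finset.sum_const, Finset.card_univ, Fintype.card_fin, nsmul_eq_mul]
  ring

theorem sum_edgeFactor_mul_edgeFactor (n : ℕ) (p p' : R × R) (i j : Fin n) :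
    ∑ c, edgeFactor p s(i, c) * edgeFactor p' s(j, c) =
      edgeFactor (series (n : R) p p') s(i, j) := by
  have hsplit : ∀ c, edgeFactor p s(i, c) * edgeFactor p' s(j, c) =
      p.1 * edgeFactor p' s(j, c) + if i = c then (p.2 - p.1) * edgeFactor p' s(j, c) else 0 := by
    intro c
    rw [edgeFactor_mk]
    split_ifs <;> ring
  simp only [hsplit, Finset.sum_add_distrib, Finset.sum_ite_eq, Finset.mem_univ, if_true,
    ← Finset.mul_sum, sum_edgeFactor]
  simp only [edgeFactor_mk, series, eq_comm (a := j)]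
  split_ifs <;> ring

end Weights

section EdgeProducts

variable {V W M : Type*} [CommMonoid M] {G : SimpleGraph V} {H : SimpleGraph W} {u v : V}

theorem prod_edgeFinset_iso [Fintype G.edgeSet] [Fintype H.edgeSet] (φ : G ≃g H)
    (f : Sym2 W → M) : ∏ e ∈ G.edgeFinset, f (e.map φ) = ∏ e ∈ H.edgeFinset, f e := by
  simp only [edgeFinset, ← Finset.prod_set_coe]
  exact Fintype.prod_equiv φ.mapEdgeSet _ _ fun _ => rfl

variable [DecidableEq V] [Fintype G.edgeSet] [Fintype (G.doubleSubdivision u v).edgeSet]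

theorem edgeFinset_doubleSubdivision :
    (G.doubleSubdivision u v).edgeFinset =
      (G.edgeFinset.erase s(u, v)).image (Sym2.map .inl) ∪
        (Finset.univ ×ˢ {u, v}).image fun p : Fin 2 × V => s(.inl p.2, .inr p.1) := by
  ext ⟨a, b⟩
  rw [mem_edgeFinset, mem_edgeSet]
  simp only [Finset.mem_union, Finset.mem_image, Finset.mem_erase, mem_edgeFinset, Sym2.exists,
    mem_edgeSet, Sym2.map_mk, Finset.mem_product, Prod.exists, Finset.mem_univ, true_and,
    Finset.mem_insert, Finset.mem_singleton]
  rcases a with x | i <;> rcases b with y | j <;>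
    grind [G.adj_comm, doubleSubdivision_adj_inl_inl, doubleSubdivision_adj_inl_inr,
      doubleSubdivision_adj_inr_inl, not_doubleSubdivision_adj_inr_inr]

theorem prod_edgeFinset_doubleSubdivision (huv : u ≠ v) (f : Sym2 (V ⊕ Fin 2) → M) :
    ∏ e ∈ (G.doubleSubdivision u v).edgeFinset, f e =
      (∏ e ∈ G.edgeFinset.erase s(u, v), f (e.map .inl)) *
        ∏ i, f s(.inl u, .inr i) * f s(.inl v, .inr i) := by
  rw [edgeFinset_doubleSubdivision, Finset.prod_union, Finset.prod_image, Finset.prod_image,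
    Finset.prod_product]
  · simp only [Finset.prod_pair huv]
  · rintro ⟨i, x⟩ - ⟨j, y⟩ - h
    simpa [and_comm] using h
  · exact (Sym2.map.injective Sum.inl_injective).injOn
  · simp only [Finset.disjoint_left, Finset.mem_image]
    rintro _ ⟨⟨x, y⟩, -, rfl⟩ ⟨p, -, hp⟩
    simp at hp

end EdgeProducts

section PartitionFunction

variable {V W : Type*} [Fintype V] [Fintype W] {G : SimpleGraph V} {H : SimpleGraph W}
  {R S : Type*} [CommRing R] [CommRing S]

open Classical in
/-- The sum over the colourings of `V` with `q` colours of the product of the edge contributions,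
in the Fortuin–Kasteleyn form, which makes sense for all `q`. -/
noncomputable def partitionFunction (G : SimpleGraph V) (q : R) (w : Sym2 V → R × R) : R :=
  ∑ F ∈ G.edgeFinset.powerset, q ^ Nat.card (fromEdgeSet (F : Set (Sym2 V))).ConnectedComponent *
    ((∏ e ∈ F, ((w e).2 - (w e).1)) * ∏ e ∈ G.edgeFinset \ F, (w e).1)

theorem map_partitionFunction (φ : R →+* S) (q : R) (w : Sym2 V → R × R) :
    φ (partitionFunction G q w) = partitionFunction G (φ q) (φ.prodMap φ ∘ w) := by
  simp [partitionFunction]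

theorem eval_partitionFunction_X (q : R) (w : Sym2 V → R[X] × R[X]) :
    (partitionFunction G Polynomial.X w).eval q =
      partitionFunction G q fun e => ((w e).1.eval q, (w e).2.eval q) := by
  simpa [Function.comp_def, Prod.map] using
    map_partitionFunction (G := G) (Polynomial.evalRingHom q) Polynomial.X w

theorem sum_prod_ite_isDiag [DecidableEq V] (F : Finset (Sym2 V)) (n : ℕ) :
    ∑ f : V → Fin n, ∏ e ∈ F, (if (e.map f).IsDiag then (1 : R) else 0) =
      n ^ Nat.card (fromEdgeSet (F : Set (Sym2 V))).ConnectedComponent := by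
  have hprod : ∀ f : V → Fin n, ∏ e ∈ F, (if (e.map f).IsDiag then (1 : R) else 0) =
      if ∀ a b, s(a, b) ∈ (F : Set (Sym2 V)) → f a = f b then 1 else 0 := by
    intro f
    simp only [Finset.prod_ite_zero, Finset.prod_const_one, Sym2.forall, Sym2.map_mk,
      Sym2.mk_isDiag_iff, Finset.mem_coe]
  rw [← Nat.cast_pow, ← card_constant_on_edges, Nat.card_eq_fintype_card, Fintype.card_subtype,
    Finset.card_filter, Nat.cast_sum]
  simp only [hprod, Nat.cast_ite, Nat.cast_one, Nat.cast_zero]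

theorem partitionFunction_natCast [DecidableEq V] [Fintype G.edgeSet] (n : ℕ) (w : Sym2 V → R × R) :
    partitionFunction G (n : R) w =
      ∑ f : V → Fin n, ∏ e ∈ G.edgeFinset, edgeFactor (w e) (e.map f) := by
  have hsplit : ∀ (f : V → Fin n) e, edgeFactor (w e) (e.map f) =
      (if (e.map f).IsDiag then 1 else 0) * ((w e).2 - (w e).1) + (w e).1 := by
    intro f e
    unfold edgeFactor
    split_ifs <;> ring
  simp only [hsplit, Finset.prod_add, Finset.prod_mul_distrib]
  rw [Finset.sum_comm]
  simp only [mul_assoc, ← Finset.sum_mul, sum_prod_ite_isDiag, partitionFunction]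
  congr!

open Classical in
theorem natCast_card_coloring (n : ℕ) :
    (Nat.card (G.Coloring (Fin n)) : R) =
      ∑ f : V → Fin n, ∏ e ∈ G.edgeFinset, edgeFactor ((1, 0) : R × R) (e.map f) := by
  let φ : G.Coloring (Fin n) ≃ {f : V → Fin n // ∀ a b, G.Adj a b → f a ≠ f b} :=
    { toFun := fun c => ⟨c, fun _ _ => c.valid⟩
      invFun := fun f => Coloring.mk f.1 fun {a b} => f.2 a b
      left_inv := fun _ => rfl
      right_inv := fun _ => rfl }
  have hprod : ∀ f : V → Fin n, ∏ e ∈ G.edgeFinset, edgeFactor ((1, 0) : R × R) (e.map f) =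
      if ∀ a b, G.Adj a b → f a ≠ f b then 1 else 0 := by
    intro f
    have hfactor : ∀ e : Sym2 V, edgeFactor ((1, 0) : R × R) (e.map f) =
        if ¬ (e.map f).IsDiag then 1 else 0 := fun e => by simp [edgeFactor]
    simp only [hfactor, Finset.prod_ite_zero, Finset.prod_const_one, Sym2.forall,
      Sym2.map_mk, Sym2.mk_isDiag_iff, mem_edgeFinset, mem_edgeSet, ne_eq]
  rw [Nat.card_congr φ, Nat.card_eq_fintype_card, Fintype.card_subtype, Finset.card_filter,
    Nat.cast_sum]
  simp only [hprod, Nat.cast_ite, Nat.cast_one, Nat.cast_zero]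

theorem eq_of_forall_eval_natCast [IsDomain R] [CharZero R] {p p' : R[X]}
    (h : ∀ n : ℕ, p.eval (n : R) = p'.eval (n : R)) : p = p' := by
  refine Polynomial.eq_of_infinite_eval_eq _ _
    ((Set.infinite_range_of_injective (Nat.cast_injective (R := R))).mono ?_)
  rintro _ ⟨n, rfl⟩
  exact h n

theorem aeval_chromaticPolynomial (G : SimpleGraph V) (q : R) :
    Polynomial.aeval q G.chromaticPolynomial = partitionFunction G q fun _ => (1, 0) := by
  classical
  have hpoly : G.chromaticPolynomial = partitionFunction G Polynomial.X fun _ => (1, 0) := by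
    refine eq_of_forall_eval_natCast fun n => ?_
    simp [chromaticPolynomial_eval, natCast_card_coloring, partitionFunction_natCast,
      eval_partitionFunction_X, -Nat.card_eq_fintype_card]
  have hmap := map_partitionFunction (G := G) (Polynomial.eval₂RingHom (Int.castRingHom R) q)
    Polynomial.X fun _ => (1, 0)
  simpa [hpoly, Polynomial.aeval_def, Function.comp_def] using hmap

theorem partitionFunction_congr_of_forall_natCast [IsDomain R] [CharZero R]
    {w : Sym2 V → R × R} {p : R[X]} (h : ∀ n : ℕ, partitionFunction G (n : R) w = p.eval (n : R))
    (q : R) : partitionFunction G q w = p.eval q := by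
  have hp : partitionFunction G Polynomial.X
      (fun e => (Polynomial.C (w e).1, Polynomial.C (w e).2)) = p :=
    eq_of_forall_eval_natCast fun n => by simpa [eval_partitionFunction_X] using h n
  simp [← hp, eval_partitionFunction_X]

theorem partitionFunction_iso [IsDomain R] [CharZero R] (φ : G ≃g H) (q : R)
    (w : Sym2 W → R × R) :
    partitionFunction G q (w ∘ Sym2.map φ) = partitionFunction H q w := by
  classical
  have hnat : ∀ n : ℕ, partitionFunction G (n : R) (w ∘ Sym2.map φ) =
      partitionFunction H (n : R) w := by
    intro n
    simp only [partitionFunction_natCast]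
    refine (Fintype.sum_equiv (φ.symm.toEquiv.arrowCongr (.refl _)) _ _ fun f => ?_).symm
    rw [← prod_edgeFinset_iso φ]
    exact Finset.prod_congr rfl fun e _ => congrArg (edgeFactor (w (e.map φ))) (Sym2.map_map ..)
  simpa [eval_partitionFunction_X] using partitionFunction_congr_of_forall_natCast
    (p := partitionFunction H Polynomial.X fun e => (Polynomial.C (w e).1, Polynomial.C (w e).2))
    (by simpa [eval_partitionFunction_X] using hnat) q

end PartitionFunction

section Reduction

variable {V : Type*} {G : SimpleGraph V} {u v : V} {R S : Type*} [CommRing R] [CommRing S]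

/-- The weight of the edge that can replace the four edges at the new vertices of a double
subdivision of `uv`: two parallel pairs of edges in series. -/
def squareWeight (q : R) (u v : V) (w : Sym2 (V ⊕ Fin 2) → R × R) : R × R :=
  ∏ i : Fin 2, series q (w s(.inl u, .inr i)) (w s(.inl v, .inr i))

open Classical in
/-- The weights on a graph that give it the partition function of its double subdivision at `uv`
with weights `w`. -/
noncomputable def reduceWeights (q : R) (u v : V) (w : Sym2 (V ⊕ Fin 2) → R × R) :
    Sym2 V → R × R :=
  Function.update (w ∘ Sym2.map .inl) s(u, v) (squareWeight q u v w)

theorem reduceWeights_self (q : R) (w : Sym2 (V ⊕ Fin 2) → R × R) :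
    reduceWeights q u v w s(u, v) = squareWeight q u v w := by
  simp [reduceWeights]

theorem reduceWeights_of_ne (q : R) (w : Sym2 (V ⊕ Fin 2) → R × R) {e : Sym2 V}
    (he : e ≠ s(u, v)) : reduceWeights q u v w e = w (e.map .inl) := by
  simp [reduceWeights, he]

theorem map_reduceWeights (φ : R →+* S) (q : R) (w : Sym2 (V ⊕ Fin 2) → R × R) (e : Sym2 V) :
    φ.prodMap φ (reduceWeights q u v w e) =
      reduceWeights (φ q) u v (φ.prodMap φ ∘ w) e := by
  obtain rfl | he := eq_or_ne e s(u, v)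
  · simp only [reduceWeights_self, squareWeight, map_prod, map_series, Function.comp_apply]
  · simp only [reduceWeights_of_ne _ _ he, Function.comp_apply]

variable [Fintype V]

theorem partitionFunction_doubleSubdivision_natCast (huv : G.Adj u v) (n : ℕ)
    (w : Sym2 (V ⊕ Fin 2) → R × R) :
    partitionFunction (G.doubleSubdivision u v) (n : R) w =
      partitionFunction G (n : R) (reduceWeights (n : R) u v w) := by
  classical
  have hold : ∀ (g : V → Fin n) (k : Fin 2 → Fin n) (e : Sym2 V),
      (e.map .inl).map (Sum.elim g k) = e.map g := fun g k e => by simp [Sym2.map_map]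
  simp only [partitionFunction_natCast]
  calc ∑ f : V ⊕ Fin 2 → Fin n, ∏ e ∈ (G.doubleSubdivision u v).edgeFinset,
        edgeFactor (w e) (e.map f)
      = ∑ g : V → Fin n, ∑ k : Fin 2 → Fin n, ∏ e ∈ (G.doubleSubdivision u v).edgeFinset,
          edgeFactor (w e) (e.map (Sum.elim g k)) := by
        rw [← Fintype.sum_prod_type']
        exact (Fintype.sum_equiv (Equiv.sumArrowEquivProdArrow ..).symm _ _ fun _ => rfl).symm
    _ = ∑ g : V → Fin n, (∏ e ∈ G.edgeFinset.erase s(u, v),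
          edgeFactor (w (e.map .inl)) (e.map g)) *
          ∏ i, ∑ c, edgeFactor (w s(.inl u, .inr i)) s(g u, c) *
            edgeFactor (w s(.inl v, .inr i)) s(g v, c) := by
        refine Finset.sum_congr rfl fun g _ => ?_
        simp only [prod_edgeFinset_doubleSubdivision huv.ne, hold, ← Finset.mul_sum]
        rw [Finset.prod_univ_sum, Fintype.piFinset_univ]
        rfl
    _ = ∑ g : V → Fin n, (∏ e ∈ G.edgeFinset.erase s(u, v),
          edgeFactor (reduceWeights (n : R) u v w e) (e.map g)) *
          edgeFactor (reduceWeights (n : R) u v w s(u, v)) s(g u, g v) := by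
        refine Finset.sum_congr rfl fun g _ => ?_
        simp only [sum_edgeFactor_mul_edgeFactor, Fin.prod_univ_two, ← edgeFactor_mul,
          reduceWeights_self, squareWeight]
        congr 1
        refine Finset.prod_congr rfl fun e he => ?_
        rw [reduceWeights_of_ne _ _ (Finset.ne_of_mem_erase he)]
    _ = ∑ g : V → Fin n, ∏ e ∈ G.edgeFinset,
          edgeFactor (reduceWeights (n : R) u v w e) (e.map g) :=
        Finset.sum_congr rfl fun g _ => Finset.prod_erase_mul _ _ (mem_edgeFinset.2 huv)

theorem partitionFunction_doubleSubdivision [IsDomain R] [CharZero R] (huv : G.Adj u v) (q : R)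
    (w : Sym2 (V ⊕ Fin 2) → R × R) :
    partitionFunction (G.doubleSubdivision u v) q w =
      partitionFunction G q (reduceWeights q u v w) := by
  let ψ := (Polynomial.C : R →+* R[X]).prodMap (Polynomial.C : R →+* R[X])
  have heval : ∀ r : R, (partitionFunction G Polynomial.X
      (reduceWeights Polynomial.X u v (ψ ∘ w))).eval r =
        partitionFunction G r (reduceWeights r u v w) := by
    intro r
    let χ := Polynomial.evalRingHom r
    have hw : χ.prodMap χ ∘ ψ ∘ w = w := by ext e <;> simp [χ, ψ]
    calc χ (partitionFunction G Polynomial.X (reduceWeights Polynomial.X u v (ψ ∘ w)))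
        = partitionFunction G (χ Polynomial.X)
            (reduceWeights (χ Polynomial.X) u v (χ.prodMap χ ∘ ψ ∘ w)) := by
          rw [map_partitionFunction]
          exact congrArg _ (funext (map_reduceWeights χ _ _))
      _ = partitionFunction G r (reduceWeights r u v w) := by
          rw [hw, Polynomial.coe_evalRingHom, Polynomial.eval_X]
  rw [← heval q]
  refine partitionFunction_congr_of_forall_natCast (fun n => ?_) q
  rw [heval, partitionFunction_doubleSubdivision_natCast huv]

end Reduction

section Triangle

variable {R : Type*} [CommRing R]

theorem sum_edgeFactor_triangle (n : ℕ) (p p' p'' : R × R) :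
    ∑ f : Fin 3 → Fin n,
        edgeFactor p s(f 0, f 2) * edgeFactor p' s(f 1, f 2) * edgeFactor p'' s(f 0, f 1) =
      n * ((series (n : R) p p' * p'').2 + (n - 1) * (series (n : R) p p' * p'').1) := by
  let φ : (Fin 3 → Fin n) ≃ Fin n × Fin n × Fin n :=
    { toFun := fun f => (f 0, f 1, f 2)
      invFun := fun c => ![c.1, c.2.1, c.2.2]
      left_inv := fun f => by ext i; fin_cases i <;> rfl
      right_inv := fun _ => rfl }
  calc _ = ∑ i : Fin n, ∑ j : Fin n, (∑ c, edgeFactor p s(i, c) * edgeFactor p' s(j, c)) *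
          edgeFactor p'' s(i, j) := by
        simp only [Finset.sum_mul, ← Fintype.sum_prod_type']
        exact Fintype.sum_equiv φ _ _ fun f => rfl
    _ = ∑ i : Fin n, ∑ j : Fin n, edgeFactor (series (n : R) p p' * p'') s(i, j) := by
        simp only [sum_edgeFactor_mul_edgeFactor, edgeFactor_mul]
    _ = _ := by
        simp only [sum_edgeFactor, Finset.sum_const, Finset.card_univ, Fintype.card_fin,
          nsmul_eq_mul]

theorem partitionFunction_triangle [IsDomain R] [CharZero R] (q : R) (w : Sym2 (Fin 3) → R × R) :
    partitionFunction (⊤ : SimpleGraph (Fin 3)) q w =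
      q * ((series q (w s(0, 2)) (w s(1, 2)) * w s(0, 1)).2 +
        (q - 1) * (series q (w s(0, 2)) (w s(1, 2)) * w s(0, 1)).1) := by
  let ψ := (Polynomial.C : R →+* R[X]).prodMap (Polynomial.C : R →+* R[X])
  let s := series Polynomial.X (ψ (w s(0, 2))) (ψ (w s(1, 2))) * ψ (w s(0, 1))
  have heval : ∀ r : R, (Polynomial.X * (s.2 + (Polynomial.X - 1) * s.1)).eval r =
      r * ((series r (w s(0, 2)) (w s(1, 2)) * w s(0, 1)).2 +
        (r - 1) * (series r (w s(0, 2)) (w s(1, 2)) * w s(0, 1)).1) := by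
    intro r
    simp [s, ψ, series]
  have hedges : (⊤ : SimpleGraph (Fin 3)).edgeFinset = {s(0, 2), s(1, 2), s(0, 1)} := by decide
  rw [← heval]
  refine partitionFunction_congr_of_forall_natCast (fun n => ?_) q
  rw [heval, ← sum_edgeFactor_triangle, partitionFunction_natCast, hedges]
  simp [mul_assoc]

end Triangle

section Inequalities

variable {t : ℝ} {p p' p'' : ℝ × ℝ}

/-- The condition on edge weights that the reduction of double subdivisions preserves for
`1 < t ≤ 5 / 4`. -/
def IsAdmissible (p : ℝ × ℝ) : Prop :=
  0 < p.1 ∧ p.2 ≤ p.1 / 4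

theorem series_bounds (ht : 1 < t) (ht' : t ≤ 5 / 4) (hp : IsAdmissible p) (hp' : IsAdmissible p')
    (h : p.2 = 0 ∨ p'.2 = 0) :
    (series t p p').1 < 0 ∧ 0 < (series t p p').2 ∧ (series t p p').2 ≤ -(series t p p').1 / 2 := by
  have hpos : 0 < p.1 * p'.1 := mul_pos hp.1 hp'.1
  have hcross : p.1 * p'.2 + p.2 * p'.1 ≤ p.1 * p'.1 / 4 := by
    rcases h with h | h
    · linarith [mul_le_mul_of_nonneg_left hp'.2 hp.1.le, congrArg (· * p'.1) h]
    · linarith [mul_le_mul_of_nonneg_right hp.2 hp'.1.le, congrArg (p.1 * ·) h]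
  have hsame : p.2 * p'.2 = 0 := mul_eq_zero.2 h
  have hlower : 0 < (t - 1) * (p.1 * p'.1) := mul_pos (by linarith) hpos
  have hupper : t * (p.1 * p'.1) ≤ 5 / 4 * (p.1 * p'.1) := mul_le_mul_of_nonneg_right ht' hpos.le
  simp only [series]
  refine ⟨?_, ?_, ?_⟩ <;> linarith

theorem IsAdmissible.series_mul_series {p₁ p₁' p₂ p₂' : ℝ × ℝ} (ht : 1 < t) (ht' : t ≤ 5 / 4)
    (hp₁ : IsAdmissible p₁) (hp₁' : IsAdmissible p₁') (hp₂ : IsAdmissible p₂)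
    (hp₂' : IsAdmissible p₂') (h₁ : p₁.2 = 0 ∨ p₁'.2 = 0) (h₂ : p₂.2 = 0 ∨ p₂'.2 = 0) :
    IsAdmissible (series t p₁ p₁' * series t p₂ p₂') := by
  obtain ⟨hneg₁, hpos₁, hle₁⟩ := series_bounds ht ht' hp₁ hp₁' h₁
  obtain ⟨hneg₂, hpos₂, hle₂⟩ := series_bounds ht ht' hp₂ hp₂' h₂
  refine ⟨mul_pos_of_neg_of_neg hneg₁ hneg₂, ?_⟩
  calc (series t p₁ p₁').2 * (series t p₂ p₂').2
      ≤ -(series t p₁ p₁').1 / 2 * (-(series t p₂ p₂').1 / 2) :=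
        mul_le_mul hle₁ hle₂ hpos₂.le (hpos₁.le.trans hle₁)
    _ = (series t p₁ p₁').1 * (series t p₂ p₂').1 / 4 := by ring

theorem triangle_neg (ht : 1 < t) (ht' : t ≤ 5 / 4) (hp : IsAdmissible p) (hp' : IsAdmissible p')
    (hp'' : IsAdmissible p'') (h : p.2 = 0 ∨ p'.2 = 0 ∨ p''.2 = 0) :
    t * ((series t p p' * p'').2 + (t - 1) * (series t p p' * p'').1) < 0 := by
  obtain ⟨a, b⟩ := p
  obtain ⟨a', b'⟩ := p'
  obtain ⟨a'', b''⟩ := p''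
  simp only [IsAdmissible] at hp hp' hp'' h
  have hexpand : (series t (a, b) (a', b') * (a'', b'')).2 +
      (t - 1) * (series t (a, b) (a', b') * (a'', b'')).1 =
      (t - 1) * ((t - 2) * (a * a' * a'') + a * a' * b'' + a * b' * a'' + b * a' * a'') := by
    have hsame : b * b' * b'' = 0 := by grind
    simp only [series, Prod.fst_mul, Prod.snd_mul]
    linear_combination hsame
  have hpos : 0 < a * a' * a'' := mul_pos (mul_pos hp.1 hp'.1) hp''.1
  have hb : b * a' * a'' ≤ a * a' * a'' / 4 := by
    linarith [mul_le_mul_of_nonneg_right hp.2 (mul_pos hp'.1 hp''.1).le]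
  have hb' : a * b' * a'' ≤ a * a' * a'' / 4 := by
    linarith [mul_le_mul_of_nonneg_right hp'.2 (mul_pos hp.1 hp''.1).le]
  have hb'' : a * a' * b'' ≤ a * a' * a'' / 4 := by
    linarith [mul_le_mul_of_nonneg_right hp''.2 (mul_pos hp.1 hp'.1).le]
  have hbound : a * a' * b'' + a * b' * a'' + b * a' * a'' ≤ 2 * (a * a' * a'' / 4) := by
    rcases h with rfl | rfl | rfl <;> linarith
  rw [hexpand]
  refine mul_neg_of_pos_of_neg (by linarith) (mul_neg_of_pos_of_neg (by linarith) ?_)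
  have hupper : t * (a * a' * a'') ≤ 5 / 4 * (a * a' * a'') :=
    mul_le_mul_of_nonneg_right ht' hpos.le
  linarith

end Inequalities

section Conclusion

variable {V : Type u} {G : SimpleGraph V} {t : ℝ}

theorem IsAdmissible.reduceWeights {u v : V} (ht : 1 < t) (ht' : t ≤ 5 / 4)
    {w : Sym2 (V ⊕ Fin 2) → ℝ × ℝ}
    (hw : ∀ e ∈ (G.doubleSubdivision u v).edgeSet, IsAdmissible (w e))
    (hzero : ∀ i, (w s(.inl u, .inr i)).2 = 0 ∨ (w s(.inl v, .inr i)).2 = 0) {e : Sym2 V}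
    (he : e ∈ G.edgeSet) : IsAdmissible (reduceWeights t u v w e) := by
  obtain rfl | hne := eq_or_ne e s(u, v)
  · have hu : ∀ i, IsAdmissible (w s(.inl u, .inr i)) := fun i => hw _ (.inl rfl)
    have hv : ∀ i, IsAdmissible (w s(.inl v, .inr i)) := fun i => hw _ (.inr rfl)
    rw [reduceWeights_self, squareWeight, Fin.prod_univ_two]
    exact .series_mul_series ht ht' (hu 0) (hv 0) (hu 1) (hv 1) (hzero 0) (hzero 1)
  · rw [reduceWeights_of_ne _ _ hne]
    induction e with
    | h x y => exact hw _ ⟨he, hne⟩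

theorem partitionFunction_neg (hG : G.IsGeneralisedTriangle)
    (ht : 1 < t) (ht' : t ≤ 5 / 4) :
    ∀ [Fintype V] (w : Sym2 V → ℝ × ℝ), (∀ e ∈ G.edgeSet, IsAdmissible (w e)) →
      HasRelativeP1 G {e | (w e).2 = 0} → partitionFunction G t w < 0 := by
  induction hG with
  | triangle G φ =>
    intro _ w hw hP1
    rw [← partitionFunction_iso φ.symm, partitionFunction_triangle]
    have hadj : ∀ i j, i ≠ j → G.Adj (φ.symm i) (φ.symm j) := fun i j hij =>
      φ.symm.map_adj_iff.2 hij
    have hzero := hP1.mem_of_triangle (.triangle G φ) (hadj 0 2 (by decide))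
      (hadj 2 1 (by decide)) (hadj 0 1 (by decide))
    rw [Sym2.eq_swap (a := φ.symm 2)] at hzero
    exact triangle_neg ht ht' (hw _ (hadj 0 2 (by decide))) (hw _ (hadj 1 2 (by decide)))
      (hw _ (hadj 0 1 (by decide))) hzero
  | @doubleSubdivision V _ G G' u v hG huv φ ih =>
    intro _ w hw hP1
    have : Finite V := (finite_and_odd_card hG).1
    have := Fintype.ofFinite V
    rw [← partitionFunction_iso φ.symm, partitionFunction_doubleSubdivision huv]
    have hP1' := hP1.comap_iso φ.symm
    have hw' : ∀ e ∈ (G.doubleSubdivision u v).edgeSet, IsAdmissible ((w ∘ Sym2.map φ.symm) e) :=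
      fun e he => hw _ (φ.symm.mapEdgeSet ⟨e, he⟩).2
    have hzero := fun i => hP1'.inl_inr_mem hG huv i
    refine ih _ (fun e he => .reduceWeights ht ht' hw' hzero he)
      (hP1'.of_doubleSubdivision huv fun e hne he => ?_)
    rwa [Set.mem_ofPred_eq, reduceWeights_of_ne _ _ hne]

end Conclusion

end GeneralisedTriangle

open GeneralisedTriangle in
theorem lemma14 {V : Type u} [Fintype V] (G : SimpleGraph V) (hG : G.IsInK1)
    (t : ℝ) (ht : t ∈ Set.Ioc (1 : ℝ) (5 / 4)) :
    0 < (-1 : ℝ) ^ Fintype.card V * Polynomial.aeval t G.chromaticPolynomial := by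
  have hodd : Odd (Fintype.card V) :=
    Nat.card_eq_fintype_card (α := V) ▸ (finite_and_odd_card hG.1).2
  have hneg : partitionFunction G t (fun _ => (1, 0)) < 0 :=
    partitionFunction_neg hG.1 ht.1 ht.2 _ (fun _ _ => by norm_num [IsAdmissible])
      (by simpa [Set.ofPred_true] using hasRelativeP1_univ hG)
  rwa [hodd.neg_one_pow, neg_one_mul, aeval_chromaticPolynomial, Left.neg_pos_iff]
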